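/- Let $(\eta_j)_{j\in\mathbb Z}$ be independent identically distributed real random variables with $\mathsf E\eta_1=0$ and $0<\sigma_\eta^2:=\mathsf E\eta_1^2<\infty$, where $\sigma_\eta>0$. Let $(\psi_j)_{j\ge 0}$ be real numbers with $\sum_{j\ge0}|\psi_j|<\infty$ and $A_\psi:=\sum_{j\ge0}\psi_j\neq0$, and let $X_i=\sum_{j\ge0}\psi_j\eta_{i-j}$ (almost surely convergent series), $i\in\mathbb Z$, be the corresponding short-memory linear process. For $f\colon[0,1]\to\mathbb R$ and $n\ge1$ put $\nu_n(f):=\sum_{i=1}^n X_i f(i/n)$. Let $\nu$ be the isonormal Gaussian process on $\mathcal L^2[0,1]$, i.e. a centred Gaussian process indexed by the functions on $[0,1]$ that are square integrable for Lebesgue measure $\lambda$, with $\mathsf E[\nu(f)\nu(g)]=\int_0^1 fg\,d\lambda$. For $q\ge1$ let $\mathcal W_q[0,1]$ be the set of functions $g\colon[0,1]\to\mathbb R$ with finite $q$-variation $\sup\{\sum_{i=1}^m|g(t_i)-g(t_{i-1})|^q\colon 0=t_0<\dots<t_m=1,\ m\ge1\}$. Let $1\le q<2$ and $g_1,\dots,g_d\in\mathcal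 W_q[0,1]$. Then $g_1,\dots,g_d\in\mathcal L^2[0,1]$ and, as $n\to\infty$, $$n^{-1/2}\big(\nu_n(g_1),\dots,\nu_n(g_d)\big)\xrightarrow{\mathscr D}\sigma_\eta A_\psi\big(\nu(g_1),\dots,\nu(g_d)\big).$$ Moreover, $(\nu(g_1),\dots,\nu(g_d))$ is jointly Gaussian with mean zero and covariances $\int_0^1 g_ig_j\,d\lambda$; hence the limit vector is jointly Gaussian with mean zero and covariances $\sigma_\eta^2A_\psi^2\int_0^1 g_ig_j\,d\lambda$. -/

import Mathlib

open MeasureTheory ProbabilityTheory Filter Topology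
open scoped ENNReal

noncomputable section

/-- The `p`-variation `v_p(g; [a, b])` of `g` on `[a, b]`: the supremum, possibly infinite, of
`∑_{i=1}^m |g(t_i) - g(t_{i-1})|^p` over all partitions `a = t_0 < t_1 < ⋯ < t_m = b`.
A function on `[a, b]` is represented by a function on `ℝ`, of which only the values on `[a, b]`
are used. -/
def pVariation (p : ℝ) (g : ℝ → ℝ) (a b : ℝ) : ℝ≥0∞ :=
  ⨆ (m : ℕ) (t : ℕ → ℝ) (_ : (∀ i < m, t i < t (i + 1)) ∧ t 0 = a ∧ t m = b),
    ∑ i ∈ Finset.range m, ENNReal.ofReal (|g (t (i + 1)) - g (t i)| ^ p)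

/-- The class `𝓦_p[a, b]` of functions of bounded `p`-variation on `[a, b]`. -/
def boundedPVariation (p a b : ℝ) : Set (ℝ → ℝ) :=
  {g | pVariation p g a b < ∞}

/-- The standard deviation `σ_η = (E η₁²)^{1/2}` of (centred) innovations. -/
def innovationSD {Ω : Type*} [MeasurableSpace Ω] (P : Measure Ω) (η : ℤ → Ω → ℝ) : ℝ :=
  √(∫ ω, (η 1 ω) ^ 2 ∂P)

/-- The sum `A_ψ = ∑_j ψ_j` of a summable filter. -/
def filterSum (ψ : ℕ → ℝ) : ℝ := ∑' j, ψ j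

/-- `X` is a short-memory linear process with innovations `η` and summable filter `ψ`:
`η` is a sequence of independent identically distributed random variables with mean zero and
finite nonzero second moment, `∑ |ψ_j| < ∞`, `A_ψ ≠ 0`, and, for each `i`, the series
`∑_{j ≥ 0} ψ_j η_{i-j}` converges almost surely to `X_i`. -/
structure IsShortMemoryLinearProcess {Ω : Type*} [MeasurableSpace Ω] (P : Measure Ω)
    (η : ℤ → Ω → ℝ) (ψ : ℕ → ℝ) (X : ℤ → Ω → ℝ) : Prop where
  measurable_innovation : ∀ j, Measurable (η j)
  indep : iIndepFun η P
  identDistrib : ∀ j, IdentDistrib (η j) (η 1) P P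
  memLp_two : MemLp (η 1) 2 P
  mean_zero : ∫ ω, η 1 ω ∂P = 0
  second_moment_ne_zero : ∫ ω, (η 1 ω) ^ 2 ∂P ≠ 0
  summable_filter : Summable fun j => |ψ j|
  filterSum_ne_zero : filterSum ψ ≠ 0
  series : ∀ i : ℤ, ∀ᵐ ω ∂P,
    Tendsto (fun N : ℕ => ∑ j ∈ Finset.range N, ψ j * η (i - j) ω) atTop (𝓝 (X i ω))

/-- The `n`-th `f`-weighted sum `ν_n(f) = ∑_{i=1}^n X_i f(i/n)`. -/
def weightedSum {Ω : Type*} (X : ℤ → Ω → ℝ) (n : ℕ) (f : ℝ → ℝ) (ω : Ω) : ℝ :=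
  ∑ i ∈ Finset.Icc 1 n, X (i : ℤ) ω * f ((i : ℝ) / (n : ℝ))

/-- The class `𝓛²[0, 1]` of functions that are square integrable on `[0, 1]` for Lebesgue
measure. -/
def squareIntegrable01 : Set (ℝ → ℝ) :=
  {f | MemLp f 2 (volume.restrict (Set.Icc (0 : ℝ) 1))}

/-- `ν` is an isonormal Gaussian process on `𝓛²[0, 1]`: its restriction to `𝓛²[0, 1]` is a centred
Gaussian process with `E[ν(f) ν(g)] = ∫₀¹ f g dλ`. -/
structure IsIsonormalProcess {Ω : Type*} [MeasurableSpace Ω] (P : Measure Ω)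
    (ν : (ℝ → ℝ) → Ω → ℝ) : Prop where
  gaussian : IsGaussianProcess (fun f : squareIntegrable01 => ν f) P
  mean_zero : ∀ f ∈ squareIntegrable01, ∫ ω, ν f ω ∂P = 0
  second_moment : ∀ f ∈ squareIntegrable01, ∀ g ∈ squareIntegrable01,
    ∫ ω, ν f ω * ν g ω ∂P = ∫ x in Set.Icc (0 : ℝ) 1, f x * g x

end

/-!
The linear process is replaced by its innovations, and the innovations obey a weighted central
limit theorem.

*Regularity of the weights.* If `g` has bounded `q`-variation, then `W x = v_q(g; [0, x])` is
monotone and `|g y - g x| ^ q ≤ W y - W x` for `x ≤ y`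
(`exists_control_of_boundedPVariation`). Hence `g` is bounded, it is continuous wherever `W` is, so
at all but countably many points, and since `q ≤ 2` the sums of its squared increments along
partitions are bounded (`exists_sum_sq_le_of_boundedPVariation`). Products of two such functions are
therefore Riemann integrable: their Riemann sums converge to the Lebesgue integral
(`tendsto_riemannSum_mul_of_boundedPVariation`).

*Comparison in mean square.* Interchanging the sums, `ν_n(g) = ∑_j ψ_j U_j` with
`U_j = ∑_{i ≤ n} η_{i-j} g(i/n)`. The innovations are orthogonal, so that summation by parts and the
bound on squared increments give `‖U_{j+1} - U_j‖₂ ≤ K` with `K` independent of `n` and `j`.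
Together with the trivial bound,
`n^{-1/2} ‖U_j - U_0‖₂ ≤ const · min(j n^{-1/2}, 1)`, and dominated convergence for the summable
sequence `|ψ_j|` shows that `n^{-1/2} (ν_n(g) - A_ψ U_0)` tends to zero in `L²`
(`IsShortMemoryLinearProcess.tendsto_eLpNorm_weightedSum_sub`).

*Central limit theorem.* The characteristic function of a linear combination of the normalized sums
`U_0` is a product of values of the characteristic function `φ` of `η₁` at uniformly small points.
Since `φ` differs from the characteristic function of the centred normal law with the same variance
by `o(t²)` at zero, the product may be computed with the latter, where it only depends on the sum of
the squares of the weights, a Riemann sum (`tendsto_prod_charFun`). The Cramér–Wold device and Lévy's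
theorem (`tendstoInDistribution_of_tendsto_charFun_sum`) conclude.
-/

/-! ### Functions of bounded `q`-variation -/

/-- The `q`-variation is superadditive when the interval is prolonged by one increment. -/
lemma pVariation_add_le {q a x y : ℝ} (g : ℝ → ℝ) (hax : a ≤ x) (hxy : x < y) :
    pVariation q g a x + ENNReal.ofReal (|g y - g x| ^ q) ≤ pVariation q g a y := by
  set c := ENNReal.ofReal (|g y - g x| ^ q)
  have key : ∀ (m : ℕ) (t : ℕ → ℝ), (∀ i < m, t i < t (i + 1)) ∧ t 0 = a ∧ t m = x →
      (∑ i ∈ Finset.range m, ENNReal.ofReal (|g (t (i + 1)) - g (t i)| ^ q)) + c ≤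
        pVariation q g a y := by
    rintro m t ⟨h1, h2, h3⟩
    refine le_trans (le_of_eq ?_) (le_iSup_of_le (m + 1) (le_iSup_of_le
      (fun i => if i ≤ m then t i else y) (le_iSup_of_le ⟨?_, ?_, ?_⟩ le_rfl)))
    · rw [Finset.sum_range_succ]
      congr 1
      · refine Finset.sum_congr rfl fun i hi => ?_
        have := Finset.mem_range.1 hi
        simp [this.le, Nat.succ_le_of_lt this]
      · simp [h3, c]
    · intro i hi
      rcases (Nat.lt_succ_iff.1 hi).lt_or_eq with h | h
      · simpa [h.le, Nat.succ_le_of_lt h] using h1 i h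
      · simpa [h, h3] using hxy
    · simpa using h2
    · simp
  -- Needed separately because subtraction in `ℝ≥0∞` is truncated.
  have hc : c ≤ pVariation q g a y := by
    rcases hax.eq_or_lt with h | h
    · exact le_add_self.trans (key 0 (fun _ => a) ⟨by simp, rfl, h⟩)
    · exact le_add_self.trans (key 1 (fun i => if i = 0 then a else x) ⟨by simpa, by simp, by simp⟩)
  refine (add_le_add_left (?_ : _ ≤ pVariation q g a y - c) c).trans_eq (tsub_add_cancel_of_le hc)
  exact iSup_le fun m => iSup_le fun t => iSup_le fun h =>
    ENNReal.le_sub_of_add_le_right ENNReal.ofReal_ne_top (key m t h)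

/-- The variation function `W x = v_q(g; [0, x])` of a function of bounded `q`-variation controls
all its increments. -/
lemma exists_control_of_boundedPVariation {q : ℝ} (hq : 0 < q) {g : ℝ → ℝ}
    (hg : g ∈ boundedPVariation q 0 1) :
    ∃ W : ℝ → ℝ, ∀ x y, 0 ≤ x → x ≤ y → y ≤ 1 → |g y - g x| ^ q ≤ W y - W x := by
  have hfin : ∀ x, 0 ≤ x → x ≤ 1 → pVariation q g 0 x ≠ ∞ := fun x hx hx1 => by
    rcases hx1.eq_or_lt with rfl | h
    · exact ne_of_lt hg
    · exact ne_top_of_le_ne_top (ne_of_lt hg) (le_self_add.trans (pVariation_add_le g hx h))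
  refine ⟨fun x => (pVariation q g 0 x).toReal, fun x y hx hxy hy => ?_⟩
  rcases hxy.eq_or_lt with rfl | h
  · simp [Real.zero_rpow hq.ne']
  have := ENNReal.toReal_mono (hfin y (hx.trans hxy) hy) (pVariation_add_le (q := q) g hx h)
  rw [ENNReal.toReal_add (hfin x hx (hxy.trans hy)) ENNReal.ofReal_ne_top,
    ENNReal.toReal_ofReal (by positivity)] at this
  dsimp only
  linarith

lemma exists_bound_of_boundedPVariation {q : ℝ} (hq : 0 < q) {g : ℝ → ℝ}
    (hg : g ∈ boundedPVariation q 0 1) :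
    ∃ M, 0 ≤ M ∧ ∀ x ∈ Set.Icc (0 : ℝ) 1, |g x| ≤ M := by
  obtain ⟨W, hW⟩ := exists_control_of_boundedPVariation hq hg
  have h0 : 0 ≤ W 1 - W 0 := le_trans (by positivity) (hW 0 1 le_rfl zero_le_one le_rfl)
  refine ⟨|g 0| + (W 1 - W 0) ^ q⁻¹, by positivity, fun x hx => ?_⟩
  have h1 : |g x - g 0| ≤ (W 1 - W 0) ^ q⁻¹ := by
    rw [Real.le_rpow_inv_iff_of_pos (abs_nonneg _) h0 hq]
    have h2 : 0 ≤ W 1 - W x := le_trans (by positivity) (hW x 1 hx.1 hx.2 le_rfl)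
    linarith [hW 0 x le_rfl hx.1 hx.2]
  calc |g x| = |g 0 + (g x - g 0)| := by ring_nf
    _ ≤ _ := (abs_add_le _ _).trans (by gcongr)

/-- A function of bounded `q`-variation is continuous wherever its (monotone) variation function
is, hence at all but countably many points. -/
lemma ae_continuousWithinAt_of_boundedPVariation {q : ℝ} (hq : 0 < q) {g : ℝ → ℝ}
    (hg : g ∈ boundedPVariation q 0 1) :
    ∀ᵐ x ∂volume.restrict (Set.Icc (0 : ℝ) 1), ContinuousWithinAt g (Set.Icc 0 1) x := by
  obtain ⟨W, hW⟩ := exists_control_of_boundedPVariation hq hg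
  have hmono : MonotoneOn W (Set.Icc 0 1) := fun x hx y hy hxy => by
    have : 0 ≤ W y - W x := le_trans (by positivity) (hW x y hx.1 hxy hy.2)
    linarith
  rw [ae_restrict_iff' measurableSet_Icc]
  filter_upwards [hmono.countable_not_continuousWithinAt.ae_notMem volume] with x hx hxI
  have hWc : ContinuousWithinAt W (Set.Icc 0 1) x := by
    by_contra h
    exact hx ⟨hxI, h⟩
  have habs : Tendsto (fun y => |W y - W x| ^ q⁻¹) (𝓝[Set.Icc 0 1] x) (𝓝 0) := by
    have h1 : Tendsto (fun y => |W y - W x|) (𝓝[Set.Icc 0 1] x) (𝓝 0) := by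
      simpa using (hWc.tendsto.sub_const (W x)).abs
    simpa [Real.zero_rpow (inv_ne_zero hq.ne')] using
      h1.rpow_const (p := q⁻¹) (Or.inr (inv_nonneg.2 hq.le))
  refine tendsto_iff_dist_tendsto_zero.2 (squeeze_zero' (.of_forall fun _ => dist_nonneg) ?_ habs)
  filter_upwards [self_mem_nhdsWithin] with y hy
  rw [Real.dist_eq, Real.le_rpow_inv_iff_of_pos (abs_nonneg _) (abs_nonneg _) hq]
  rcases le_total x y with h | h
  · exact (hW x y hxI.1 h hy.2).trans (le_abs_self _)
  · rw [abs_sub_comm, abs_sub_comm (W y)]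
    exact (hW y x hy.1 h hxI.2).trans (le_abs_self _)

/-- For `q ≤ 2`, bounded `q`-variation implies that the sums of squared increments along
partitions are bounded. -/
lemma exists_sum_sq_le_of_boundedPVariation {q : ℝ} (hq : 0 < q) (hq2 : q ≤ 2) {g : ℝ → ℝ}
    (hg : g ∈ boundedPVariation q 0 1) :
    ∃ C, 0 ≤ C ∧ ∀ (m : ℕ) (t : ℕ → ℝ), 0 ≤ t 0 → t m ≤ 1 → Monotone t →
      ∑ i ∈ Finset.range m, (g (t (i + 1)) - g (t i)) ^ 2 ≤ C := by
  obtain ⟨W, hW⟩ := exists_control_of_boundedPVariation hq hg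
  obtain ⟨M, hM0, hM⟩ := exists_bound_of_boundedPVariation hq hg
  have h0 : 0 ≤ W 1 - W 0 := le_trans (by positivity) (hW 0 1 le_rfl zero_le_one le_rfl)
  refine ⟨(2 * M) ^ (2 - q) * (W 1 - W 0), by positivity, fun m t ht0 htm hmono => ?_⟩
  have hI : ∀ i ≤ m, t i ∈ Set.Icc (0 : ℝ) 1 := fun i hi =>
    ⟨ht0.trans (hmono i.zero_le), (hmono hi).trans htm⟩
  calc ∑ i ∈ Finset.range m, (g (t (i + 1)) - g (t i)) ^ 2
      ≤ ∑ i ∈ Finset.range m, (2 * M) ^ (2 - q) * (W (t (i + 1)) - W (t i)) := by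
        refine Finset.sum_le_sum fun i hi => ?_
        have hi' := Finset.mem_range.1 hi
        have hx := hI i hi'.le
        have hy := hI (i + 1) hi'
        have hb : |g (t (i + 1)) - g (t i)| ≤ 2 * M :=
          (abs_sub _ _).trans (by linarith [hM _ hx, hM _ hy])
        calc (g (t (i + 1)) - g (t i)) ^ 2
            = |g (t (i + 1)) - g (t i)| ^ ((2 - q) + q) := by
              rw [← sq_abs]; norm_num
          _ = |g (t (i + 1)) - g (t i)| ^ (2 - q) * |g (t (i + 1)) - g (t i)| ^ q :=
              Real.rpow_add_of_nonneg (abs_nonneg _) (by linarith) hq.le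
          _ ≤ _ := by
              have h1 := hW _ _ hx.1 (hmono i.le_succ) hy.2
              gcongr
    _ = (2 * M) ^ (2 - q) * (W (t m) - W (t 0)) := by
        rw [← Finset.mul_sum, Finset.sum_range_sub (fun i => W (t i))]
    _ ≤ _ := by
        have h1 : 0 ≤ W (t 0) - W 0 :=
          le_trans (by positivity) (hW 0 (t 0) le_rfl ht0 (hI 0 m.zero_le).2)
        have h2 : 0 ≤ W 1 - W (t m) :=
          le_trans (by positivity) (hW (t m) 1 (hI m le_rfl).1 htm le_rfl)
        gcongr <;> linarith

/-! ### Riemann sums of almost everywhere continuous functions -/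

lemma natCeil_mul_div_mem_Icc {x : ℝ} (hx : x ∈ Set.Icc (0 : ℝ) 1) (n : ℕ) :
    (⌈x * n⌉₊ : ℝ) / n ∈ Set.Icc (0 : ℝ) 1 := by
  refine ⟨by positivity, div_le_one_of_le₀ ?_ (by positivity)⟩
  exact_mod_cast Nat.ceil_le.2 (mul_le_of_le_one_left (by positivity) hx.2)

lemma measurable_comp_natCeil_mul_div (F : ℝ → ℝ) (n : ℕ) :
    Measurable fun x : ℝ => F ((⌈x * n⌉₊ : ℝ) / n) :=
  (measurable_of_countable fun k : ℕ => F ((k : ℝ) / n)).comp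
    (Nat.measurable_ceil.comp (measurable_id.mul_const (n : ℝ)))

/-- The Riemann sum with right endpoints is the integral of the corresponding step function. -/
lemma integral_comp_natCeil_mul_div (F : ℝ → ℝ) {n : ℕ} (hn : n ≠ 0) :
    ∫ x in Set.Icc (0 : ℝ) 1, F ((⌈x * n⌉₊ : ℝ) / n) =
      (n : ℝ)⁻¹ * ∑ i ∈ Finset.Icc 1 n, F ((i : ℝ) / n) := by
  have hn0 : (0 : ℝ) < n := by positivity
  have hstep : ∀ k : ℕ, Set.EqOn (fun _ : ℝ => F (((k + 1 : ℕ) : ℝ) / n))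
      (fun x : ℝ => F ((⌈x * n⌉₊ : ℝ) / n)) (Set.uIoc ((k : ℝ) / n) (((k + 1 : ℕ) : ℝ) / n)) := by
    intro k x hx
    have hle : (k : ℝ) / n ≤ ((k + 1 : ℕ) : ℝ) / n := by gcongr; exact k.le_succ
    rw [Set.uIoc_of_le hle] at hx
    have : ⌈x * n⌉₊ = k + 1 := by
      rw [Nat.ceil_eq_iff k.succ_ne_zero]
      exact ⟨by simpa using (div_lt_iff₀ hn0).1 hx.1, by simpa using (le_div_iff₀ hn0).1 hx.2⟩
    simp [this]
  have hsum := intervalIntegral.sum_integral_adjacent_intervals (μ := volume)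
    (f := fun x : ℝ => F ((⌈x * n⌉₊ : ℝ) / n)) (a := fun k : ℕ => (k : ℝ) / n) (n := n)
    fun k _ => (intervalIntegrable_const (c := F (((k + 1 : ℕ) : ℝ) / n))).congr (hstep k)
  rw [integral_Icc_eq_integral_Ioc, ← intervalIntegral.integral_of_le zero_le_one]
  simp only [CharP.cast_eq_zero, zero_div, div_self hn0.ne'] at hsum
  rw [← hsum, Finset.mul_sum, ← Finset.Ico_succ_right_eq_Icc, Finset.sum_Ico_eq_sum_range]
  refine Finset.sum_congr rfl fun k _ => ?_
  rw [← intervalIntegral.integral_congr_ae (.of_forall (hstep k)),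
    intervalIntegral.integral_const, smul_eq_mul, add_comm 1 k]
  push_cast
  congr 1
  field_simp
  ring

lemma ae_tendsto_comp_natCeil_mul_div {F : ℝ → ℝ}
    (hF : ∀ᵐ x ∂volume.restrict (Set.Icc (0 : ℝ) 1), ContinuousWithinAt F (Set.Icc 0 1) x) :
    ∀ᵐ x : ℝ ∂volume.restrict (Set.Icc (0 : ℝ) 1),
      Tendsto (fun n : ℕ => F ((⌈x * n⌉₊ : ℝ) / n)) atTop (𝓝 (F x)) := by
  filter_upwards [hF, ae_restrict_mem measurableSet_Icc] with x hx hxI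
  refine hx.tendsto.comp (tendsto_nhdsWithin_iff.2
    ⟨?_, .of_forall fun n => natCeil_mul_div_mem_Icc hxI n⟩)
  exact (tendsto_nat_ceil_mul_div_atTop hxI.1).comp tendsto_natCast_atTop_atTop

lemma aemeasurable_of_ae_continuousWithinAt {F : ℝ → ℝ}
    (hF : ∀ᵐ x ∂volume.restrict (Set.Icc (0 : ℝ) 1), ContinuousWithinAt F (Set.Icc 0 1) x) :
    AEMeasurable F (volume.restrict (Set.Icc (0 : ℝ) 1)) :=
  aemeasurable_of_tendsto_metrizable_ae atTop
    (fun n => (measurable_comp_natCeil_mul_div F n).aemeasurable)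
    (ae_tendsto_comp_natCeil_mul_div hF)

/-- Riemann sums of a bounded, almost everywhere continuous function converge to its Lebesgue
integral. -/
lemma tendsto_riemannSum_of_ae_continuousWithinAt {F : ℝ → ℝ} {M : ℝ}
    (hM : ∀ x ∈ Set.Icc (0 : ℝ) 1, |F x| ≤ M)
    (hF : ∀ᵐ x ∂volume.restrict (Set.Icc (0 : ℝ) 1), ContinuousWithinAt F (Set.Icc 0 1) x) :
    Tendsto (fun n : ℕ => (n : ℝ)⁻¹ * ∑ i ∈ Finset.Icc 1 n, F ((i : ℝ) / n)) atTop
      (𝓝 (∫ x in Set.Icc (0 : ℝ) 1, F x)) := by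
  have h := tendsto_integral_of_dominated_convergence (μ := volume.restrict (Set.Icc (0 : ℝ) 1))
    (fun _ => M) (fun n => (measurable_comp_natCeil_mul_div F n).aestronglyMeasurable)
    (integrable_const M)
    (fun n => (ae_restrict_mem measurableSet_Icc).mono fun x hx =>
      hM _ (natCeil_mul_div_mem_Icc hx n))
    (ae_tendsto_comp_natCeil_mul_div hF)
  refine h.congr' ?_
  filter_upwards [eventually_ne_atTop 0] with n hn using integral_comp_natCeil_mul_div F hn

lemma mem_squareIntegrable01_of_boundedPVariation {q : ℝ} (hq : 0 < q) {g : ℝ → ℝ}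
    (hg : g ∈ boundedPVariation q 0 1) : g ∈ squareIntegrable01 := by
  obtain ⟨M, -, hM⟩ := exists_bound_of_boundedPVariation hq hg
  exact MemLp.of_bound (aemeasurable_of_ae_continuousWithinAt
    (ae_continuousWithinAt_of_boundedPVariation hq hg)).aestronglyMeasurable M
    ((ae_restrict_mem measurableSet_Icc).mono fun x hx => hM x hx)

lemma tendsto_riemannSum_mul_of_boundedPVariation {q : ℝ} (hq : 0 < q) {f g : ℝ → ℝ}
    (hf : f ∈ boundedPVariation q 0 1) (hg : g ∈ boundedPVariation q 0 1) :
    Tendsto (fun n : ℕ => (n : ℝ)⁻¹ * ∑ i ∈ Finset.Icc 1 n, f ((i : ℝ) / n) * g ((i : ℝ) / n))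
      atTop (𝓝 (∫ x in Set.Icc (0 : ℝ) 1, f x * g x)) := by
  obtain ⟨M, hM0, hM⟩ := exists_bound_of_boundedPVariation hq hf
  obtain ⟨M', -, hM'⟩ := exists_bound_of_boundedPVariation hq hg
  refine tendsto_riemannSum_of_ae_continuousWithinAt (F := fun x => f x * g x) (M := M * M')
    (fun x hx => ?_) ?_
  · rw [abs_mul]
    exact mul_le_mul (hM x hx) (hM' x hx) (abs_nonneg _) hM0
  · filter_upwards [ae_continuousWithinAt_of_boundedPVariation hq hf,
      ae_continuousWithinAt_of_boundedPVariation hq hg] with x h1 h2 using h1.mul h2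

/-! ### Mean square comparison of the linear process with its innovations -/

/-- The values of `f` on the grid `{1/n, …, n/n}`, extended by zero to all of `ℕ`. -/
noncomputable def gridValue (n : ℕ) (f : ℝ → ℝ) (i : ℕ) : ℝ :=
  if 1 ≤ i ∧ i ≤ n then f ((i : ℝ) / n) else 0

/-- Summation by parts for the difference of two weighted sums whose summands are shifted against
each other by one. -/
lemma weightedSum_shift_succ_sub {Ω : Type*} (Y : ℤ → Ω → ℝ) (n : ℕ) (f : ℝ → ℝ) (j : ℤ) (ω : Ω) :
    weightedSum (fun i => Y (i - (j + 1))) n f ω - weightedSum (fun i => Y (i - j)) n f ω =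
      ∑ i ∈ Finset.range (n + 1),
        (gridValue n f (i + 1) - gridValue n f i) * Y ((i : ℤ) - j) ω := by
  simp_rw [sub_mul, Finset.sum_sub_distrib]
  congr 1
  · rw [Finset.sum_range_succ, weightedSum, ← Finset.Ico_succ_right_eq_Icc,
      Finset.sum_Ico_eq_sum_range]
    have h0 : gridValue n f (n + 1) = 0 := by simp [gridValue]
    rw [h0, zero_mul, add_zero]
    refine Finset.sum_congr rfl fun i hi => ?_
    have hi' : i < n := by simpa using hi
    have h1 : gridValue n f (i + 1) = f (((1 + i : ℕ) : ℝ) / n) := by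
      rw [gridValue, if_pos ⟨by omega, by omega⟩, add_comm]
    rw [h1, mul_comm]
    congr 2
    push_cast
    ring
  · rw [Finset.sum_range_succ', weightedSum, ← Finset.Ico_succ_right_eq_Icc,
      Finset.sum_Ico_eq_sum_range]
    have h0 : gridValue n f 0 = 0 := by simp [gridValue]
    rw [h0, zero_mul, add_zero]
    refine Finset.sum_congr rfl fun i hi => ?_
    have hi' : i < n := by simpa using hi
    have h1 : gridValue n f (i + 1) = f (((1 + i : ℕ) : ℝ) / n) := by
      rw [gridValue, if_pos ⟨by omega, by omega⟩, add_comm]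
    rw [h1, mul_comm, add_comm 1 i]

lemma sum_sq_gridValue_sub_le {f : ℝ → ℝ} {M C : ℝ} (hC0 : 0 ≤ C)
    (hM : ∀ x ∈ Set.Icc (0 : ℝ) 1, |f x| ≤ M)
    (hC : ∀ (m : ℕ) (t : ℕ → ℝ), 0 ≤ t 0 → t m ≤ 1 → Monotone t →
      ∑ i ∈ Finset.range m, (f (t (i + 1)) - f (t i)) ^ 2 ≤ C) (n : ℕ) :
    ∑ i ∈ Finset.range (n + 1), (gridValue n f (i + 1) - gridValue n f i) ^ 2 ≤
      2 * M ^ 2 + C := by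
  rcases n with _ | m
  · have h : gridValue 0 f 1 - gridValue 0 f 0 = 0 := by simp [gridValue]
    simp only [zero_add, Finset.sum_range_one, h, zero_pow two_ne_zero]
    positivity
  have hsq : ∀ x ∈ Set.Icc (0 : ℝ) 1, f x ^ 2 ≤ M ^ 2 := fun x hx =>
    sq_le_sq' (by linarith [abs_le.1 (hM x hx)]) (by linarith [abs_le.1 (hM x hx)])
  have hval : ∀ i, i < m + 1 →
      gridValue (m + 1) f (i + 1) = f (((i : ℝ) + 1) / ((m : ℝ) + 1)) := fun i hi => by
    rw [gridValue, if_pos ⟨by omega, by omega⟩]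
    push_cast
    rfl
  have h0 : gridValue (m + 1) f 0 = 0 := by simp [gridValue]
  have hend : gridValue (m + 1) f (m + 1 + 1) = 0 := by simp [gridValue]
  have hmid := hC m (fun i => ((i : ℝ) + 1) / ((m : ℝ) + 1)) (by positivity)
    (by rw [div_self (by positivity)]) fun a b h => by
      dsimp only
      gcongr
  rw [Finset.sum_range_succ, Finset.sum_range_succ', h0, hend, hval 0 (by omega),
    hval m (by omega)]
  have hsum : ∑ k ∈ Finset.range m,
      (gridValue (m + 1) f (k + 1 + 1) - gridValue (m + 1) f (k + 1)) ^ 2 ≤ C := by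
    refine le_trans (le_of_eq (Finset.sum_congr rfl fun k hk => ?_)) hmid
    have := Finset.mem_range.1 hk
    rw [hval k (by omega), hval (k + 1) (by omega)]
  -- The two boundary terms of the summation by parts contribute `M ^ 2` each.
  have ha := hsq (((0 : ℕ) + 1 : ℝ) / ((m : ℝ) + 1)) ⟨by positivity,
    div_le_one_of_le₀ (by simp) (by positivity)⟩
  have hb := hsq (((m : ℝ) + 1) / ((m : ℝ) + 1)) ⟨by positivity, div_self_le_one _⟩
  simp only [zero_sub, sub_zero, neg_sq] at *
  linarith

section LinearProcess

variable {Ω : Type*} [MeasurableSpace Ω] {P : Measure Ω} {η : ℤ → Ω → ℝ} {ψ : ℕ → ℝ}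
  {X : ℤ → Ω → ℝ}

lemma measurable_weightedSum {Y : ℤ → Ω → ℝ} (hY : ∀ i, Measurable (Y i)) (n : ℕ) (f : ℝ → ℝ) :
    Measurable (weightedSum Y n f) :=
  Finset.measurable_fun_sum _ fun i _ => (hY i).mul_const _

lemma innovationSD_nonneg : 0 ≤ innovationSD P η := Real.sqrt_nonneg _

lemma innovationSD_sq : innovationSD P η ^ 2 = ∫ ω, η 1 ω ^ 2 ∂P :=
  Real.sq_sqrt (integral_nonneg fun _ => sq_nonneg _)

namespace IsShortMemoryLinearProcess

lemma memLp (hX : IsShortMemoryLinearProcess P η ψ X) (j : ℤ) : MemLp (η j) 2 P :=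
  (hX.identDistrib j).memLp_iff.2 hX.memLp_two

lemma aemeasurable (hX : IsShortMemoryLinearProcess P η ψ X) (i : ℤ) : AEMeasurable (X i) P :=
  aemeasurable_of_tendsto_metrizable_ae atTop
    (f := fun (N : ℕ) ω => ∑ j ∈ Finset.range N, ψ j * η (i - j) ω)
    (fun N => (Finset.measurable_fun_sum (Finset.range N) fun (j : ℕ) _ =>
      (hX.measurable_innovation (i - j)).const_mul (ψ j)).aemeasurable) (hX.series i)

lemma summable_abs_filter_mul_min (hX : IsShortMemoryLinearProcess P η ψ X) {a b : ℝ}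
    (ha : 0 ≤ a) (hb : 0 ≤ b) : Summable fun j : ℕ => |ψ j| * min (j * a) b :=
  Summable.of_nonneg_of_le (fun j => by positivity)
    (fun j => mul_le_mul_of_nonneg_left (min_le_right _ _) (abs_nonneg _))
    (hX.summable_filter.mul_right b)

variable [IsProbabilityMeasure P]

/-- The innovations are orthogonal with norm `σ_η` in `L²`. -/
lemma eLpNorm_sum_innovation (hX : IsShortMemoryLinearProcess P η ψ X) {ι : Type*} (s : Finset ι)
    {τ : ι → ℤ} (hτ : Function.Injective τ) (c : ι → ℝ) :
    eLpNorm (fun ω => ∑ i ∈ s, c i * η (τ i) ω) 2 P =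
      ENNReal.ofReal (innovationSD P η * √(∑ i ∈ s, c i ^ 2)) := by
  have hm : ∀ i, MemLp (fun ω => c i * η (τ i) ω) 2 P := fun i => (hX.memLp _).const_mul _
  have hmean : ∀ j, ∫ ω, η j ω ∂P = 0 := fun j => by
    rw [(hX.identDistrib j).integral_eq, hX.mean_zero]
  have hL : MemLp (fun ω => ∑ i ∈ s, c i * η (τ i) ω) 2 P := memLp_finsetSum _ fun i _ => hm i
  have h0 : ∫ ω, ∑ i ∈ s, c i * η (τ i) ω ∂P = 0 := by
    rw [integral_finsetSum _ fun i _ => (hm i).integrable one_le_two]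
    simp [integral_const_mul, hmean]
  have hvar : ∫ ω, (∑ i ∈ s, c i * η (τ i) ω) ^ 2 ∂P =
      innovationSD P η ^ 2 * ∑ i ∈ s, c i ^ 2 := by
    rw [← variance_of_integral_eq_zero hL.1.aemeasurable h0]
    have h1 := IndepFun.variance_sum (X := fun i ω => c i * η (τ i) ω) (s := s) (fun i _ => hm i)
      fun i _ j _ hij => (hX.indep.indepFun (hτ.ne hij)).comp
        (measurable_const_mul (c i)) (measurable_const_mul (c j))
    have h2 : (∑ i ∈ s, fun ω => c i * η (τ i) ω) = fun ω => ∑ i ∈ s, c i * η (τ i) ω := by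
      ext; simp
    rw [h2] at h1
    rw [h1, Finset.mul_sum]
    refine Finset.sum_congr rfl fun i _ => ?_
    rw [variance_const_mul, (hX.identDistrib _).variance_eq,
      variance_of_integral_eq_zero hX.memLp_two.1.aemeasurable hX.mean_zero, innovationSD_sq,
      mul_comm]
  rw [hL.eLpNorm_eq_integral_rpow_norm two_ne_zero ENNReal.ofNat_ne_top]
  have h3 : ∫ ω, ‖∑ i ∈ s, c i * η (τ i) ω‖ ^ (2 : ℝ≥0∞).toReal ∂P =
      innovationSD P η ^ 2 * ∑ i ∈ s, c i ^ 2 := by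
    rw [← hvar]
    simp
  rw [h3, ENNReal.toReal_ofNat, ← one_div, ← Real.sqrt_eq_rpow, Real.sqrt_mul (sq_nonneg _),
    Real.sqrt_sq innovationSD_nonneg]

lemma eLpNorm_weightedSum_shift_le (hX : IsShortMemoryLinearProcess P η ψ X) {f : ℝ → ℝ} {M : ℝ}
    (hM0 : 0 ≤ M) (hM : ∀ x ∈ Set.Icc (0 : ℝ) 1, |f x| ≤ M) (n : ℕ) (j : ℤ) :
    eLpNorm (weightedSum (fun i => η (i - j)) n f) 2 P ≤
      ENNReal.ofReal (innovationSD P η * (M * √n)) := by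
  have h1 : weightedSum (fun i => η (i - j)) n f =
      fun ω => ∑ i ∈ Finset.Icc 1 n, f ((i : ℝ) / n) * η ((i : ℤ) - j) ω := by
    ext ω
    simp [weightedSum, mul_comm]
  rw [h1, hX.eLpNorm_sum_innovation _ (τ := fun i : ℕ => (i : ℤ) - j)
    fun a b h => by simpa using h]
  refine ENNReal.ofReal_le_ofReal (mul_le_mul_of_nonneg_left ?_ innovationSD_nonneg)
  rw [← Real.sqrt_sq hM0, ← Real.sqrt_mul (sq_nonneg _)]
  refine Real.sqrt_le_sqrt ?_
  calc ∑ i ∈ Finset.Icc 1 n, f ((i : ℝ) / n) ^ 2 ≤ ∑ i ∈ Finset.Icc 1 n, M ^ 2 := by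
        refine Finset.sum_le_sum fun i hi => sq_le_sq' ?_ ?_
        all_goals
          have hi' := Finset.mem_Icc.1 hi
          have := abs_le.1 (hM ((i : ℝ) / n) ⟨by positivity,
            div_le_one_of_le₀ (by exact_mod_cast hi'.2) (by positivity)⟩)
          linarith
    _ = M ^ 2 * n := by simp [mul_comm]

end IsShortMemoryLinearProcess

namespace IsShortMemoryLinearProcess

variable [IsProbabilityMeasure P]

/-- Shifting the innovations by `j` changes a weighted sum in `L²` by at most a multiple of `j`,
uniformly in the number of summands; for large `j` the trivial bound is better. -/
lemma eLpNorm_weightedSum_shift_sub_le (hX : IsShortMemoryLinearProcess P η ψ X) {f : ℝ → ℝ}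
    {M C : ℝ} (hM0 : 0 ≤ M) (hC0 : 0 ≤ C) (hM : ∀ x ∈ Set.Icc (0 : ℝ) 1, |f x| ≤ M)
    (hC : ∀ (m : ℕ) (t : ℕ → ℝ), 0 ≤ t 0 → t m ≤ 1 → Monotone t →
      ∑ i ∈ Finset.range m, (f (t (i + 1)) - f (t i)) ^ 2 ≤ C) (n j : ℕ) :
    eLpNorm (weightedSum (fun i => η (i - j)) n f - weightedSum η n f) 2 P ≤
      ENNReal.ofReal (innovationSD P η * min (j * √(2 * M ^ 2 + C)) (2 * M * √n)) := by
  have hmeas : ∀ j : ℤ, AEStronglyMeasurable (weightedSum (fun i => η (i - j)) n f) P := fun j =>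
    (measurable_weightedSum (fun i => hX.measurable_innovation (i - j)) n f).aestronglyMeasurable
  have hzero : weightedSum η n f = weightedSum (fun i => η (i - (0 : ℤ))) n f := by simp
  have hσ : 0 ≤ innovationSD P η := innovationSD_nonneg
  rw [mul_min_of_nonneg _ _ hσ, ENNReal.ofReal_min]
  refine le_min ?_ ?_
  · induction j with
    | zero => simp
    | succ j ih =>
      have hstep : eLpNorm (weightedSum (fun i => η (i - ((j : ℤ) + 1))) n f -
          weightedSum (fun i => η (i - (j : ℤ))) n f) 2 P ≤
          ENNReal.ofReal (innovationSD P η * √(2 * M ^ 2 + C)) := by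
        have h1 : weightedSum (fun i => η (i - ((j : ℤ) + 1))) n f -
            weightedSum (fun i => η (i - (j : ℤ))) n f = fun ω => ∑ i ∈ Finset.range (n + 1),
              (gridValue n f (i + 1) - gridValue n f i) * η ((i : ℤ) - j) ω := by
          ext ω
          exact weightedSum_shift_succ_sub η n f j ω
        rw [h1, hX.eLpNorm_sum_innovation _ (τ := fun i : ℕ => (i : ℤ) - j)
          fun a b h => by simpa using h]
        exact ENNReal.ofReal_le_ofReal (mul_le_mul_of_nonneg_left
          (Real.sqrt_le_sqrt (sum_sq_gridValue_sub_le hC0 hM hC n)) hσ)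
      have h2 : weightedSum (fun i => η (i - ((j + 1 : ℕ) : ℤ))) n f - weightedSum η n f =
          (weightedSum (fun i => η (i - ((j : ℤ) + 1))) n f -
            weightedSum (fun i => η (i - (j : ℤ))) n f) +
          (weightedSum (fun i => η (i - (j : ℤ))) n f - weightedSum η n f) := by
        rw [sub_add_sub_cancel]
        push_cast
        rfl
      rw [h2]
      refine (eLpNorm_add_le ((hmeas _).sub (hmeas _))
        ((hmeas _).sub (hzero ▸ hmeas 0)) one_le_two).trans ((add_le_add hstep ih).trans ?_)
      rw [← ENNReal.ofReal_add (by positivity) (by positivity)]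
      refine ENNReal.ofReal_le_ofReal (le_of_eq ?_)
      push_cast
      ring
  · rw [hzero]
    refine (eLpNorm_sub_le (hmeas _) (hmeas _) one_le_two).trans
      ((add_le_add (hX.eLpNorm_weightedSum_shift_le hM0 hM n _)
        (hX.eLpNorm_weightedSum_shift_le hM0 hM n _)).trans ?_)
    rw [← ENNReal.ofReal_add (by positivity) (by positivity)]
    refine ENNReal.ofReal_le_ofReal (le_of_eq ?_)
    ring

/-- The `j`-th shifted sum enters the weighted sum of the linear process with coefficient `ψ_j`, so
the estimates for single shifts add up. The series defining the process converges only almost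
surely, whence the passage to the limit by Fatou's lemma. -/
lemma eLpNorm_weightedSum_sub_le (hX : IsShortMemoryLinearProcess P η ψ X) {f : ℝ → ℝ}
    {M C : ℝ} (hM0 : 0 ≤ M) (hC0 : 0 ≤ C) (hM : ∀ x ∈ Set.Icc (0 : ℝ) 1, |f x| ≤ M)
    (hC : ∀ (m : ℕ) (t : ℕ → ℝ), 0 ≤ t 0 → t m ≤ 1 → Monotone t →
      ∑ i ∈ Finset.range m, (f (t (i + 1)) - f (t i)) ^ 2 ≤ C) (n : ℕ) :
    eLpNorm (fun ω => weightedSum X n f ω - filterSum ψ * weightedSum η n f ω) 2 P ≤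
      ENNReal.ofReal (innovationSD P η *
        ∑' j : ℕ, |ψ j| * min (j * √(2 * M ^ 2 + C)) (2 * M * √n)) := by
  have hσ : 0 ≤ innovationSD P η := innovationSD_nonneg
  have hsum := hX.summable_abs_filter_mul_min (a := √(2 * M ^ 2 + C)) (b := 2 * M * √n)
    (by positivity) (by positivity)
  have hmeas : ∀ j : ℕ, AEStronglyMeasurable
      (weightedSum (fun i => η (i - j)) n f - weightedSum η n f) P := fun j =>
    ((measurable_weightedSum (fun i => hX.measurable_innovation (i - j)) n f).sub
      (measurable_weightedSum hX.measurable_innovation n f)).aestronglyMeasurable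
  -- The partial sums of the series over `j`, in the form suited to the triangle inequality.
  set D : ℕ → Ω → ℝ := fun N => ∑ j ∈ Finset.range N,
    ψ j • (weightedSum (fun i => η (i - j)) n f - weightedSum η n f) with hD
  have hlim : ∀ᵐ ω ∂P, Tendsto (fun N => D N ω) atTop
      (𝓝 (weightedSum X n f ω - filterSum ψ * weightedSum η n f ω)) := by
    have hall : ∀ᵐ ω ∂P, ∀ i : ℤ, Tendsto
        (fun N : ℕ => ∑ j ∈ Finset.range N, ψ j * η (i - j) ω) atTop (𝓝 (X i ω)) :=
      ae_all_iff.2 hX.series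
    filter_upwards [hall] with ω hω
    have h1 : Tendsto (fun N : ℕ => ∑ i ∈ Finset.Icc 1 n,
        (∑ j ∈ Finset.range N, ψ j * η ((i : ℤ) - j) ω) * f ((i : ℝ) / n)) atTop
        (𝓝 (weightedSum X n f ω)) :=
      tendsto_finsetSum _ fun i _ => (hω i).mul_const _
    have h2 : Tendsto (fun N : ℕ => (∑ j ∈ Finset.range N, ψ j) * weightedSum η n f ω) atTop
        (𝓝 (filterSum ψ * weightedSum η n f ω)) :=
      (hX.summable_filter.of_abs.hasSum.tendsto_sum_nat).mul_const _
    refine (h1.sub h2).congr fun N => ?_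
    simp only [hD, Finset.sum_apply, Pi.smul_apply, Pi.sub_apply, smul_eq_mul, mul_sub,
      Finset.sum_sub_distrib, Finset.sum_mul]
    congr 1
    rw [Finset.sum_comm]
    refine Finset.sum_congr rfl fun j _ => ?_
    simp only [weightedSum, Finset.mul_sum, mul_assoc]
  refine (Lp.eLpNorm_lim_le_liminf_eLpNorm (f := D)
    (fun N => Finset.aestronglyMeasurable_sum _ fun j _ => (hmeas j).const_smul _) _ hlim).trans ?_
  refine (liminf_le_liminf (.of_forall fun N => ?_)).trans (liminf_const _).le
  refine (eLpNorm_sum_le (fun j _ => (hmeas j).const_smul _) one_le_two).trans ?_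
  calc ∑ j ∈ Finset.range N,
        eLpNorm (ψ j • (weightedSum (fun i => η (i - j)) n f - weightedSum η n f)) 2 P
      ≤ ∑ j ∈ Finset.range N, ENNReal.ofReal (innovationSD P η *
          (|ψ j| * min (j * √(2 * M ^ 2 + C)) (2 * M * √n))) := by
        refine Finset.sum_le_sum fun j _ => ?_
        rw [eLpNorm_const_smul, mul_left_comm, ENNReal.ofReal_mul (abs_nonneg _),
          Real.enorm_eq_ofReal_abs]
        gcongr
        exact hX.eLpNorm_weightedSum_shift_sub_le hM0 hC0 hM hC n j
    _ = ENNReal.ofReal (∑ j ∈ Finset.range N, innovationSD P η *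
          (|ψ j| * min (j * √(2 * M ^ 2 + C)) (2 * M * √n))) :=
        (ENNReal.ofReal_sum_of_nonneg fun j _ => by positivity).symm
    _ ≤ _ := by
        rw [← Finset.mul_sum]
        refine ENNReal.ofReal_le_ofReal (mul_le_mul_of_nonneg_left ?_ hσ)
        exact hsum.sum_le_tsum _ fun j _ => by positivity

/-- After normalization, the weighted sums of the linear process are asymptotically equivalent in
`L²` to `A_ψ` times the weighted sums of the innovations. -/
lemma tendsto_eLpNorm_weightedSum_sub (hX : IsShortMemoryLinearProcess P η ψ X) {q : ℝ}
    (hq : 0 < q) (hq2 : q ≤ 2) {f : ℝ → ℝ} (hf : f ∈ boundedPVariation q 0 1) :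
    Tendsto (fun n : ℕ => eLpNorm (fun ω => (n : ℝ) ^ (-(1 / 2) : ℝ) * weightedSum X n f ω -
      (n : ℝ) ^ (-(1 / 2) : ℝ) * (filterSum ψ * weightedSum η n f ω)) 2 P) atTop (𝓝 0) := by
  obtain ⟨M, hM0, hM⟩ := exists_bound_of_boundedPVariation hq hf
  obtain ⟨C, hC0, hC⟩ := exists_sum_sq_le_of_boundedPVariation hq hq2 hf
  set K := √(2 * M ^ 2 + C)
  have hr : Tendsto (fun n : ℕ => (n : ℝ) ^ (-(1 / 2) : ℝ)) atTop (𝓝 0) :=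
    (tendsto_rpow_neg_atTop (by norm_num)).comp tendsto_natCast_atTop_atTop
  have hrn : ∀ n : ℕ, (n : ℝ) ^ (-(1 / 2) : ℝ) * √n ≤ 1 := fun n => by
    rw [Real.rpow_neg (Nat.cast_nonneg n), ← Real.sqrt_eq_rpow]
    exact inv_mul_le_one
  have hreal : Tendsto (fun n : ℕ => ∑' j : ℕ,
      (n : ℝ) ^ (-(1 / 2) : ℝ) * (|ψ j| * min (j * K) (2 * M * √n))) atTop (𝓝 0) := by
    have h := tendsto_tsum_of_dominated_convergence (𝓕 := atTop)
      (f := fun (n : ℕ) (j : ℕ) => (n : ℝ) ^ (-(1 / 2) : ℝ) *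
        (|ψ j| * min (j * K) (2 * M * √n))) (g := fun _ => 0)
      (bound := fun j => |ψ j| * (2 * M)) (hX.summable_filter.mul_right _) (fun j => ?_)
      (.of_forall fun n j => ?_)
    · simpa using h
    · have hlim := hr.mul_const (|ψ j| * (j * K))
      rw [zero_mul] at hlim
      refine squeeze_zero (fun n => by positivity) (fun n => ?_) hlim
      have := min_le_left (j * K) (2 * M * √n)
      gcongr
    · rw [Real.norm_of_nonneg (by positivity)]
      calc (n : ℝ) ^ (-(1 / 2) : ℝ) * (|ψ j| * min (j * K) (2 * M * √n))
          ≤ (n : ℝ) ^ (-(1 / 2) : ℝ) * (|ψ j| * (2 * M * √n)) := by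
            have := min_le_right (j * K) (2 * M * √n)
            gcongr
        _ = |ψ j| * (2 * M) * ((n : ℝ) ^ (-(1 / 2) : ℝ) * √n) := by ring
        _ ≤ |ψ j| * (2 * M) * 1 := by
            gcongr
            exact hrn n
        _ = _ := mul_one _
  have hlim := ENNReal.tendsto_ofReal (hreal.const_mul (innovationSD P η))
  rw [mul_zero, ENNReal.ofReal_zero] at hlim
  refine tendsto_of_tendsto_of_tendsto_of_le_of_le tendsto_const_nhds hlim
    (fun _ => zero_le) fun n => ?_
  have h1 : (fun ω => (n : ℝ) ^ (-(1 / 2) : ℝ) * weightedSum X n f ω -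
      (n : ℝ) ^ (-(1 / 2) : ℝ) * (filterSum ψ * weightedSum η n f ω)) =
      (n : ℝ) ^ (-(1 / 2) : ℝ) •
        fun ω => weightedSum X n f ω - filterSum ψ * weightedSum η n f ω := by
    ext ω
    simp [mul_sub]
  dsimp only
  rw [h1, eLpNorm_const_smul, Real.enorm_eq_ofReal (by positivity), tsum_mul_left, mul_left_comm,
    ENNReal.ofReal_mul (by positivity)]
  gcongr
  exact hX.eLpNorm_weightedSum_sub_le hM0 hC0 hM hC n

end IsShortMemoryLinearProcess

end LinearProcess

/-! ### A central limit theorem for weighted sums of independent variables -/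

lemma norm_prod_sub_prod_le_sum {ι : Type*} (s : Finset ι) {a b : ι → ℂ}
    (ha : ∀ i, ‖a i‖ ≤ 1) (hb : ∀ i, ‖b i‖ ≤ 1) :
    ‖∏ i ∈ s, a i - ∏ i ∈ s, b i‖ ≤ ∑ i ∈ s, ‖a i - b i‖ := by
  classical
  induction s using Finset.induction_on with
  | empty => simp
  | insert j s hj ih =>
    rw [Finset.prod_insert hj, Finset.prod_insert hj, Finset.sum_insert hj]
    have hprod : ‖∏ i ∈ s, b i‖ ≤ 1 := by
      rw [norm_prod]
      exact Finset.prod_le_one (fun _ _ => norm_nonneg _) fun i _ => hb i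
    calc ‖a j * ∏ i ∈ s, a i - b j * ∏ i ∈ s, b i‖
        = ‖(a j - b j) * ∏ i ∈ s, b i + a j * (∏ i ∈ s, a i - ∏ i ∈ s, b i)‖ := by ring_nf
      _ ≤ ‖a j - b j‖ * ‖∏ i ∈ s, b i‖ + ‖a j‖ * ‖∏ i ∈ s, a i - ∏ i ∈ s, b i‖ := by
          rw [← norm_mul, ← norm_mul]
          exact norm_add_le _ _
      _ ≤ ‖a j - b j‖ * 1 + 1 * ∑ i ∈ s, ‖a i - b i‖ := by
          gcongr
          exact ha j
      _ = _ := by ring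

/-- Laws with the same first two moments have characteristic functions with the same second order
Taylor expansion at zero. -/
lemma charFun_sub_charFun_isLittleO {μ ν : Measure ℝ} [IsProbabilityMeasure μ]
    [IsProbabilityMeasure ν] (hμ : MemLp id 2 μ) (hν : MemLp id 2 ν)
    (h1 : ∫ x, x ∂μ = ∫ x, x ∂ν) (h2 : ∫ x, x ^ 2 ∂μ = ∫ x, x ^ 2 ∂ν) :
    (fun t => charFun μ t - charFun ν t) =o[𝓝 0] fun t : ℝ => t ^ 2 := by
  have key : ∀ ρ : Measure ℝ, IsProbabilityMeasure ρ → MemLp id 2 ρ →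
      (fun t => charFun ρ t - (1 + ((∫ x, x ∂ρ : ℝ) : ℂ) * t * Complex.I -
        ((∫ x, x ^ 2 ∂ρ : ℝ) : ℂ) * t ^ 2 / 2)) =o[𝓝 0] fun t : ℝ => t ^ 2 := by
    intro ρ _ hρ
    have h := taylor_isLittleO_univ (x₀ := 0) (contDiff_charFun (n := 2) (by simpa using hρ))
    simp only [sub_zero] at h
    refine h.congr_left fun t => ?_
    have := taylorWithinEval_charFun_two_zero (P := ρ) (X := id) aemeasurable_id
      (by simpa using hρ) t
    simp only [Measure.map_id, id_eq, Pi.pow_apply] at this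
    rw [this]
  refine ((key μ ‹_› hμ).sub (key ν ‹_› hν)).congr_left fun t => ?_
  rw [h1, h2]
  ring

/-- If the weights of a triangular array are uniformly small and their squares sum to `s` in the
limit, then the products of the characteristic functions of a centred square integrable law at the
weights have the Gaussian limit. -/
lemma tendsto_prod_charFun {μ : Measure ℝ} [IsProbabilityMeasure μ] (hμ : MemLp id 2 μ)
    (hmean : ∫ x, x ∂μ = 0) {c : ℕ → ℕ → ℝ} {b : ℕ → ℝ} {S : ℕ → Finset ℕ} {s : ℝ}
    (hb : Tendsto b atTop (𝓝 0)) (hcb : ∀ n, ∀ i ∈ S n, |c n i| ≤ b n)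
    (hs : Tendsto (fun n => ∑ i ∈ S n, c n i ^ 2) atTop (𝓝 s)) :
    Tendsto (fun n => ∏ i ∈ S n, charFun μ (c n i)) atTop
      (𝓝 (Complex.exp (-((∫ x, x ^ 2 ∂μ) * s : ℝ) / 2))) := by
  set v := ∫ x, x ^ 2 ∂μ with hv
  have hv0 : 0 ≤ v := integral_nonneg fun _ => sq_nonneg _
  -- The products are compared with those of the normal law with the same variance.
  set ν := gaussianReal 0 v.toNNReal with hν
  have hνp (n : ℕ) : ∏ i ∈ S n, charFun ν (c n i) =
      Complex.exp (-(v * ∑ i ∈ S n, c n i ^ 2 : ℝ) / 2) := by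
    simp_rw [hν, charFun_gaussianReal, ← Complex.exp_sum]
    congr 1
    rw [Finset.mul_sum]
    push_cast
    rw [← Finset.sum_neg_distrib, Finset.sum_div]
    refine Finset.sum_congr rfl fun i _ => ?_
    simp [hv0]
    ring
  have hνlim : Tendsto (fun n => ∏ i ∈ S n, charFun ν (c n i)) atTop
      (𝓝 (Complex.exp (-(v * s : ℝ) / 2))) := by
    simp_rw [hνp]
    have hcont : Continuous fun x : ℝ => Complex.exp (-(v * x : ℝ) / 2) := by fun_prop
    exact (hcont.tendsto s).comp hs
  have hvar : ∫ x, x ^ 2 ∂ν = v := by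
    have h := variance_of_integral_eq_zero (X := fun x : ℝ => x) (μ := ν) aemeasurable_id
      (by simp [hν])
    rw [← h, hν, variance_fun_id_gaussianReal, Real.coe_toNNReal _ hv0]
  have ho := charFun_sub_charFun_isLittleO hμ (ν := ν) (memLp_id_gaussianReal 2)
    (by simp [hν, hmean]) (by rw [hvar])
  -- The difference of the products is at most the sum of the `o((c n i) ^ 2)` differences.
  have hdiff : Tendsto (fun n => ∏ i ∈ S n, charFun μ (c n i) - ∏ i ∈ S n, charFun ν (c n i))
      atTop (𝓝 0) := by
    rw [Metric.tendsto_nhds]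
    intro ε hε
    have hs1 : 0 < |s| + 1 := by positivity
    obtain ⟨δ, hδ, hδt⟩ := Metric.eventually_nhds_iff.1
      (ho.def (c := ε / (2 * (|s| + 1))) (by positivity))
    have hbδ : ∀ᶠ n in atTop, b n < δ := hb.eventually_lt_const hδ
    have hss : ∀ᶠ n in atTop, ∑ i ∈ S n, c n i ^ 2 < |s| + 1 :=
      hs.eventually_lt_const (lt_of_le_of_lt (le_abs_self s) (lt_add_one _))
    filter_upwards [hbδ, hss] with n h1 h2
    rw [dist_zero_right]
    calc ‖∏ i ∈ S n, charFun μ (c n i) - ∏ i ∈ S n, charFun ν (c n i)‖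
        ≤ ∑ i ∈ S n, ‖charFun μ (c n i) - charFun ν (c n i)‖ :=
          norm_prod_sub_prod_le_sum _ (fun _ => norm_charFun_le_one _)
            fun _ => norm_charFun_le_one _
      _ ≤ ∑ i ∈ S n, ε / (2 * (|s| + 1)) * c n i ^ 2 := by
          refine Finset.sum_le_sum fun i hi => ?_
          have h := @hδt (c n i) (by simpa using (hcb n i hi).trans_lt h1)
          simpa using h
      _ = ε / (2 * (|s| + 1)) * ∑ i ∈ S n, c n i ^ 2 := by rw [Finset.mul_sum]
      _ ≤ ε / (2 * (|s| + 1)) * (|s| + 1) := by gcongr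
      _ = ε / 2 := by field_simp
      _ < ε := half_lt_self hε
  simpa using hdiff.add hνlim

section Innovations

variable {Ω : Type*} [MeasurableSpace Ω] {P : Measure Ω} {η : ℤ → Ω → ℝ} {ψ : ℕ → ℝ}
  {X : ℤ → Ω → ℝ}

/-- Independence and identical distribution of the innovations, at the level of characteristic
functions. -/
lemma IsShortMemoryLinearProcess.charFun_map_sum (hX : IsShortMemoryLinearProcess P η ψ X)
    (s : Finset ℕ) (c : ℕ → ℝ) :
    charFun (P.map fun ω => ∑ i ∈ s, c i * η i ω) 1 =
      ∏ i ∈ s, charFun (P.map (η 1)) (c i) := by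
  have hm : ∀ i : ℕ, Measurable fun ω => c i * η i ω := fun i =>
    (hX.measurable_innovation i).const_mul _
  have hind : iIndepFun (fun (i : ℕ) ω => c i * η i ω) P :=
    (hX.indep.precomp (g := fun i : ℕ => (i : ℤ)) Nat.cast_injective).comp
      (fun i x => c i * x) fun i => measurable_const_mul (c i)
  rw [iIndepFun.charFun_map_fun_finsetSum_eq_prod (X := fun (i : ℕ) ω => c i * η i ω)
    (fun i _ => (hm i).aemeasurable) (hind.restrict s), Finset.prod_apply]
  refine Finset.prod_congr rfl fun i _ => ?_
  rw [charFun_map_mul_comp (hX.measurable_innovation i).aemeasurable, mul_one,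
    (hX.identDistrib i).map_eq]

variable [IsProbabilityMeasure P]

/-- Every linear combination of normalized weighted sums of the innovations has the
characteristic function of the expected normal law in the limit. -/
lemma IsShortMemoryLinearProcess.tendsto_charFun_sum_weightedSum
    (hX : IsShortMemoryLinearProcess P η ψ X) {q : ℝ} (hq : 0 < q) {d : ℕ} {g : Fin d → ℝ → ℝ}
    (hg : ∀ k, g k ∈ boundedPVariation q 0 1) (a : Fin d → ℝ) :
    Tendsto (fun n : ℕ => charFun (P.map fun ω =>
        ∑ k, a k * ((n : ℝ) ^ (-(1 / 2) : ℝ) * weightedSum η n (g k) ω)) 1) atTop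
      (𝓝 (Complex.exp (-(innovationSD P η ^ 2 *
        ∑ k, ∑ l, a k * a l * ∫ x in Set.Icc (0 : ℝ) 1, g k x * g l x : ℝ) / 2))) := by
  choose M hM0 hM using fun k => exists_bound_of_boundedPVariation hq (hg k)
  have hr : Tendsto (fun n : ℕ => (n : ℝ) ^ (-(1 / 2) : ℝ)) atTop (𝓝 0) :=
    (tendsto_rpow_neg_atTop (by norm_num)).comp tendsto_natCast_atTop_atTop
  have hr2 : ∀ n : ℕ, ((n : ℝ) ^ (-(1 / 2) : ℝ)) ^ 2 = (n : ℝ)⁻¹ := fun n => by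
    rw [← Real.rpow_natCast, ← Real.rpow_mul (Nat.cast_nonneg n)]
    norm_num [Real.rpow_neg_one]
  set c : ℕ → ℕ → ℝ := fun n i =>
    (n : ℝ) ^ (-(1 / 2) : ℝ) * ∑ k, a k * g k ((i : ℝ) / n) with hc
  have hηm : AEMeasurable (η 1) P := (hX.measurable_innovation 1).aemeasurable
  have : IsProbabilityMeasure (P.map (η 1)) := Measure.isProbabilityMeasure_map hηm
  have hsq : ∫ x, x ^ 2 ∂(P.map (η 1)) = innovationSD P η ^ 2 := by
    rw [integral_map hηm (by fun_prop), innovationSD_sq]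
  have h := tendsto_prod_charFun (μ := P.map (η 1)) (c := c) (S := fun n => Finset.Icc 1 n)
    (b := fun n => (n : ℝ) ^ (-(1 / 2) : ℝ) * ∑ k, |a k| * M k)
    (s := ∑ k, ∑ l, a k * a l * ∫ x in Set.Icc (0 : ℝ) 1, g k x * g l x)
    ((memLp_map_measure_iff (by fun_prop) hηm).2 hX.memLp_two)
    (by rw [integral_map hηm (by fun_prop), hX.mean_zero])
    (by simpa using hr.mul_const (∑ k, |a k| * M k)) ?_ ?_
  · rw [hsq] at h
    refine h.congr fun n => ?_
    rw [← hX.charFun_map_sum]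
    congr 2
    ext ω
    simp only [hc, weightedSum, Finset.mul_sum, Finset.sum_mul]
    rw [Finset.sum_comm]
    exact Finset.sum_congr rfl fun k _ => Finset.sum_congr rfl fun i _ => by ring
  · intro n i hi
    have hi' := Finset.mem_Icc.1 hi
    have hx : (i : ℝ) / n ∈ Set.Icc (0 : ℝ) 1 :=
      ⟨by positivity, div_le_one_of_le₀ (by exact_mod_cast hi'.2) (by positivity)⟩
    rw [hc, abs_mul, abs_of_nonneg (by positivity : (0 : ℝ) ≤ (n : ℝ) ^ (-(1 / 2) : ℝ))]
    gcongr
    refine (Finset.abs_sum_le_sum_abs _ _).trans (Finset.sum_le_sum fun k _ => ?_)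
    rw [abs_mul]
    exact mul_le_mul_of_nonneg_left (hM k _ hx) (abs_nonneg _)
  · have hlim := tendsto_finsetSum Finset.univ fun k _ => tendsto_finsetSum Finset.univ fun l _ =>
      (tendsto_riemannSum_mul_of_boundedPVariation hq (hg k) (hg l)).const_mul (a k * a l)
    refine hlim.congr fun n => ?_
    calc ∑ k, ∑ l, a k * a l *
          ((n : ℝ)⁻¹ * ∑ i ∈ Finset.Icc 1 n, g k ((i : ℝ) / n) * g l ((i : ℝ) / n))
        = ∑ k, ∑ l, ∑ i ∈ Finset.Icc 1 n,
            (n : ℝ)⁻¹ * ((a k * g k ((i : ℝ) / n)) * (a l * g l ((i : ℝ) / n))) := by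
          refine Finset.sum_congr rfl fun k _ => Finset.sum_congr rfl fun l _ => ?_
          rw [Finset.mul_sum, Finset.mul_sum]
          exact Finset.sum_congr rfl fun i _ => by ring
      _ = ∑ i ∈ Finset.Icc 1 n, ∑ k, ∑ l,
            (n : ℝ)⁻¹ * ((a k * g k ((i : ℝ) / n)) * (a l * g l ((i : ℝ) / n))) := by
          rw [Finset.sum_comm]
          simp_rw [Finset.sum_comm (s := Finset.Icc 1 n)]
          rw [Finset.sum_comm]
      _ = ∑ i ∈ Finset.Icc 1 n, c n i ^ 2 := by
          refine Finset.sum_congr rfl fun i _ => ?_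
          rw [hc, mul_pow, hr2, sq, Finset.sum_mul_sum]
          simp_rw [Finset.mul_sum]

end Innovations

/-! ### Convergence in distribution of random vectors -/

section Vectors

variable {Ω : Type*} [MeasurableSpace Ω] {P : Measure Ω} {Ω' : Type*} [MeasurableSpace Ω']
  {P' : Measure Ω'} {d : ℕ}

lemma charFun_map_toLp {V : Ω → Fin d → ℝ} (hV : AEMeasurable V P)
    (t : EuclideanSpace ℝ (Fin d)) :
    charFun (P.map fun ω => WithLp.toLp 2 (V ω)) t =
      charFun (P.map fun ω => ∑ k, t k * V ω k) 1 := by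
  have hm : AEMeasurable (fun ω => ∑ k, t k * V ω k) P := by fun_prop
  rw [charFun_apply, charFun_apply, integral_map (by fun_prop) (by fun_prop),
    integral_map hm (by fun_prop)]
  simp [PiLp.inner_apply]

lemma tendstoInMeasure_pi_of_tendsto_eLpNorm {Y : ℕ → Ω → Fin d → ℝ}
    (hY : ∀ n k, AEStronglyMeasurable (fun ω => Y n ω k) P)
    (h : ∀ k, Tendsto (fun n => eLpNorm (fun ω => Y n ω k) 2 P) atTop (𝓝 0)) :
    TendstoInMeasure P Y atTop 0 := by
  have hYm : ∀ n, AEStronglyMeasurable (Y n) P := fun n =>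
    (aemeasurable_pi_lambda _ fun k => (hY n k).aemeasurable).aestronglyMeasurable
  refine tendstoInMeasure_of_tendsto_eLpNorm (p := 2) two_ne_zero hYm
    aestronglyMeasurable_zero ?_
  have hsum := tendsto_finsetSum Finset.univ fun k _ => h k
  rw [Finset.sum_const_zero] at hsum
  refine tendsto_of_tendsto_of_tendsto_of_le_of_le tendsto_const_nhds hsum
    (fun _ => zero_le) fun n => ?_
  dsimp only
  rw [sub_zero]
  calc eLpNorm (Y n) 2 P ≤ eLpNorm (∑ k, fun ω => ‖Y n ω k‖) 2 P := by
        refine eLpNorm_mono_real fun ω => ?_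
        rw [Finset.sum_apply]
        exact (pi_norm_le_iff_of_nonneg (Finset.sum_nonneg fun _ _ => norm_nonneg _)).2 fun k =>
          Finset.single_le_sum (f := fun k => ‖Y n ω k‖) (fun _ _ => norm_nonneg _)
            (Finset.mem_univ k)
    _ ≤ ∑ k, eLpNorm (fun ω => ‖Y n ω k‖) 2 P :=
        eLpNorm_sum_le (fun k _ => (hY n k).norm) one_le_two
    _ = ∑ k, eLpNorm (fun ω => Y n ω k) 2 P := by simp_rw [eLpNorm_norm]

lemma IsIsonormalProcess.hasGaussianLaw {ν : (ℝ → ℝ) → Ω → ℝ} (hν : IsIsonormalProcess P ν)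
    {g : Fin d → ℝ → ℝ} (hg : ∀ k, g k ∈ squareIntegrable01) :
    HasGaussianLaw (fun ω k => ν (g k) ω) P := by
  have h := (hν.gaussian.comp_right fun k => (⟨g k, hg k⟩ : squareIntegrable01)).hasGaussianLaw
    Finset.univ
  exact h.map (ContinuousLinearMap.pi fun k : Fin d =>
    ContinuousLinearMap.proj (R := ℝ) (φ := fun _ : (Finset.univ : Finset (Fin d)) => ℝ)
      ⟨k, Finset.mem_univ k⟩)

variable [IsProbabilityMeasure P]

/-- The Cramér–Wold device: random vectors converge in distribution as soon as the characteristic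
functions of all linear combinations of their coordinates converge at `1`. -/
lemma tendstoInDistribution_of_tendsto_charFun_sum [IsProbabilityMeasure P']
    {V : ℕ → Ω → Fin d → ℝ}
    {Z : Ω' → Fin d → ℝ} (hV : ∀ n, AEMeasurable (V n) P)
    (hZ : AEMeasurable Z P')
    (h : ∀ a : Fin d → ℝ, Tendsto (fun n => charFun (P.map fun ω => ∑ k, a k * V n ω k) 1) atTop
      (𝓝 (charFun (P'.map fun ω => ∑ k, a k * Z ω k) 1))) :
    TendstoInDistribution V atTop Z (fun _ => P) P' := by
  have hE : TendstoInDistribution (fun n ω => WithLp.toLp 2 (V n ω)) atTop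
      (fun ω => (WithLp.toLp 2 (Z ω) : EuclideanSpace ℝ (Fin d))) (fun _ => P) P' :=
    { forall_aemeasurable := fun n => by fun_prop
      aemeasurable_limit := by fun_prop
      tendsto := by
        refine ProbabilityMeasure.tendsto_iff_tendsto_charFun.2 fun t => ?_
        simpa [charFun_map_toLp hZ, charFun_map_toLp (hV _)] using h t }
  exact hE.continuous_comp (g := fun x : EuclideanSpace ℝ (Fin d) => x.ofLp) (by fun_prop)

lemma charFun_map_sum_mul_of_hasGaussianLaw {Z : Fin d → Ω → ℝ}
    (hZ : HasGaussianLaw (fun ω k => Z k ω) P) (h0 : ∀ k, ∫ ω, Z k ω ∂P = 0) (a : Fin d → ℝ) :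
    charFun (P.map fun ω => ∑ k, a k * Z k ω) 1 =
      Complex.exp (-(∑ k, ∑ l, a k * a l * cov[Z k, Z l; P] : ℝ) / 2) := by
  have hmem : ∀ k, MemLp (fun ω => a k * Z k ω) 2 P := fun k => (hZ.eval k).memLp_two.const_mul _
  have hlaw : HasGaussianLaw (fun ω => ∑ k, a k * Z k ω) P := by
    have := hZ.map_fun (∑ k, a k • ContinuousLinearMap.proj (R := ℝ) (φ := fun _ : Fin d => ℝ) k)
    simpa using this
  have hmean : ∫ ω, ∑ k, a k * Z k ω ∂P = 0 := by
    rw [integral_finsetSum _ fun k _ => (hmem k).integrable one_le_two]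
    simp [integral_const_mul, h0]
  have hvar : Var[fun ω => ∑ k, a k * Z k ω; P] =
      ∑ k, ∑ l, a k * a l * cov[Z k, Z l; P] := by
    rw [variance_fun_sum hmem]
    refine Finset.sum_congr rfl fun k _ => Finset.sum_congr rfl fun l _ => ?_
    rw [covariance_const_mul_left, covariance_const_mul_right, mul_assoc]
  rw [hlaw.charFun_map_eq]
  simp [hmean, hvar, neg_div]

end Vectors

theorem mainTheorem11
    {Ω : Type*} [MeasurableSpace Ω] (P : Measure Ω) [IsProbabilityMeasure P]
    {Ω' : Type*} [MeasurableSpace Ω'] (P' : Measure Ω') [IsProbabilityMeasure P']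
    (η : ℤ → Ω → ℝ) (ψ : ℕ → ℝ) (X : ℤ → Ω → ℝ)
    (hX : IsShortMemoryLinearProcess P η ψ X)
    (ν : (ℝ → ℝ) → Ω' → ℝ) (hν : IsIsonormalProcess P' ν)
    (q : ℝ) (hq : 1 ≤ q) (hq' : q < 2)
    (d : ℕ) (g : Fin d → ℝ → ℝ) (hg : ∀ k, g k ∈ boundedPVariation q 0 1) :
    -- the functions lie in the index set of the isonormal process
    (∀ k, g k ∈ squareIntegrable01) ∧
    -- convergence in distribution of the normalized vector of weighted sums
    TendstoInDistribution
      (fun (n : ℕ) (ω : Ω) (k : Fin d) => (n : ℝ) ^ (-(1 / 2) : ℝ) * weightedSum X n (g k) ω)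
      atTop
      (fun (ω : Ω') (k : Fin d) => innovationSD P η * filterSum ψ * ν (g k) ω)
      (fun _ => P) P' ∧
    -- the vector `(ν(g_1), …, ν(g_d))` is centred Gaussian with covariances `∫₀¹ g_k g_l dλ`
    HasGaussianLaw (fun (ω : Ω') (k : Fin d) => ν (g k) ω) P' ∧
    (∀ k, ∫ ω, ν (g k) ω ∂P' = 0) ∧
    (∀ k l, covariance (ν (g k)) (ν (g l)) P' = ∫ x in Set.Icc (0 : ℝ) 1, g k x * g l x) ∧
    -- hence the limit is centred Gaussian with covariances `σ_η² A_ψ² ∫₀¹ g_k g_l dλ`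
    HasGaussianLaw
      (fun (ω : Ω') (k : Fin d) => innovationSD P η * filterSum ψ * ν (g k) ω) P' ∧
    (∀ k, ∫ ω, innovationSD P η * filterSum ψ * ν (g k) ω ∂P' = 0) ∧
    (∀ k l, covariance (fun ω => innovationSD P η * filterSum ψ * ν (g k) ω)
        (fun ω => innovationSD P η * filterSum ψ * ν (g l) ω) P' =
      (innovationSD P η) ^ 2 * (filterSum ψ) ^ 2 *
        ∫ x in Set.Icc (0 : ℝ) 1, g k x * g l x) := by
  have hq0 : 0 < q := one_pos.trans_le hq
  have hL2 : ∀ k, g k ∈ squareIntegrable01 := fun k =>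
    mem_squareIntegrable01_of_boundedPVariation hq0 (hg k)
  have hlaw : HasGaussianLaw (fun (ω : Ω') (k : Fin d) => ν (g k) ω) P' := hν.hasGaussianLaw hL2
  have hmean : ∀ k, ∫ ω, ν (g k) ω ∂P' = 0 := fun k => hν.mean_zero _ (hL2 k)
  have hcov : ∀ k l, covariance (ν (g k)) (ν (g l)) P' =
      ∫ x in Set.Icc (0 : ℝ) 1, g k x * g l x := fun k l => by
    rw [covariance_eq_sub (hlaw.eval k).memLp_two (hlaw.eval l).memLp_two, hmean, hmean, mul_zero,
      sub_zero]
    exact hν.second_moment _ (hL2 k) _ (hL2 l)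
  have hlaw' : HasGaussianLaw
      (fun (ω : Ω') (k : Fin d) => innovationSD P η * filterSum ψ * ν (g k) ω) P' :=
    hlaw.fun_smul (innovationSD P η * filterSum ψ)
  have hmean' : ∀ k, ∫ ω, innovationSD P η * filterSum ψ * ν (g k) ω ∂P' = 0 := fun k => by
    rw [integral_const_mul, hmean, mul_zero]
  have hcov' : ∀ k l, covariance (fun ω => innovationSD P η * filterSum ψ * ν (g k) ω)
      (fun ω => innovationSD P η * filterSum ψ * ν (g l) ω) P' =
      (innovationSD P η) ^ 2 * (filterSum ψ) ^ 2 *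
        ∫ x in Set.Icc (0 : ℝ) 1, g k x * g l x := fun k l => by
    rw [covariance_const_mul_left, covariance_const_mul_right, hcov]
    ring
  refine ⟨hL2, ?_, hlaw, hmean, hcov, hlaw', hmean', hcov'⟩
  have hηm : ∀ (n : ℕ) k, Measurable fun ω =>
      (n : ℝ) ^ (-(1 / 2) : ℝ) * (filterSum ψ * weightedSum η n (g k) ω) := fun n k =>
    ((measurable_weightedSum hX.measurable_innovation n (g k)).const_mul _).const_mul _
  have hXm : ∀ (n : ℕ) k, AEMeasurable (fun ω =>
      (n : ℝ) ^ (-(1 / 2) : ℝ) * weightedSum X n (g k) ω) P := fun n k =>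
    AEMeasurable.const_mul (f := weightedSum X n (g k))
      (Finset.aemeasurable_fun_sum _ fun i _ => (hX.aemeasurable i).mul_const _) _
  -- By the mean square comparison, the linear process may be replaced by `A_ψ η`.
  refine tendstoInDistribution_of_tendstoInMeasure_sub
    (X := fun (n : ℕ) (ω : Ω) (k : Fin d) =>
      (n : ℝ) ^ (-(1 / 2) : ℝ) * (filterSum ψ * weightedSum η n (g k) ω)) _ _ ?_ ?_
    (fun n => aemeasurable_pi_lambda _ fun k => hXm n k)
  · refine tendstoInDistribution_of_tendsto_charFun_sum
      (fun n => aemeasurable_pi_lambda _ fun k => (hηm n k).aemeasurable) hlaw'.aemeasurable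
      fun a => ?_
    have hlim := hX.tendsto_charFun_sum_weightedSum hq0 hg (fun k => a k * filterSum ψ)
    have hvar : ∑ k, ∑ l, a k * a l *
        covariance (fun ω => innovationSD P η * filterSum ψ * ν (g k) ω)
          (fun ω => innovationSD P η * filterSum ψ * ν (g l) ω) P' =
        innovationSD P η ^ 2 * ∑ k, ∑ l, a k * filterSum ψ * (a l * filterSum ψ) *
          ∫ x in Set.Icc (0 : ℝ) 1, g k x * g l x := by
      simp_rw [hcov', Finset.mul_sum]
      exact Finset.sum_congr rfl fun k _ => Finset.sum_congr rfl fun l _ => by ring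
    rw [charFun_map_sum_mul_of_hasGaussianLaw
      (Z := fun k ω => innovationSD P η * filterSum ψ * ν (g k) ω) hlaw' hmean', hvar]
    refine hlim.congr fun n => ?_
    congr 2
    ext ω
    exact Finset.sum_congr rfl fun k _ => by ring
  · exact tendstoInMeasure_pi_of_tendsto_eLpNorm
      (fun n k => ((hXm n k).sub (hηm n k).aemeasurable).aestronglyMeasurable)
      fun k => hX.tendsto_eLpNorm_weightedSum_sub hq0 hq'.le (hg k)
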